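/- Let $F$ be a field of characteristic zero, let $G$ be a connected algebraic group over $F$ (that is, a connected group scheme of finite type over $F$), let $n \ge 0$, and let $\rho_1, \rho_2 : G \to \mathrm{GL}_n$ be semisimple algebraic representations of $G$ (homomorphisms of group schemes over $F$). Here $\rho : G \to \mathrm{GL}_n$ is called semisimple if every subrepresentation of $F^n$ has a complementary subrepresentation. For $k \ge 1$ let $T^k(\rho) : G \to \mathrm{GL}_{n^k}$ denote the $k$-th tensor power of $\rho$, that is, the representation of $G$ on $(F^n)^{\otimes k}$ given by $g \mapsto \rho(g) \otimes \cdots \otimes \rho(g)$ ($k$ factors). If $$T^k(\rho_1) \simeq T^k(\rho_2)$$ for some $k \ge 1$, as representations of $G$ over $F$, then $\rho_1 \simeq \rho_2$ as representations of $G$ over $F$. -/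

import Mathlib

universe u

open CategoryTheory AlgebraicGeometry

namespace AlgGrp

open scoped MonObj Matrix

noncomputable section

/-- The structure map `F → Γ(T, 𝒪_T)` of a scheme `T` over a field `F`. -/
def scalars {F : Type u} [Field F] (T : Over (Spec (CommRingCat.of F))) :
    F →+* Γ(T.left, ⊤) :=
  (Scheme.Hom.appTop (Y := Spec (CommRingCat.of F)) T.hom).hom.comp
    (Scheme.ΓSpecIso (CommRingCat.of F)).inv.hom

/-- A (finite-dimensional, algebraic) representation of a group scheme `G` over a field `F` into
`GL_J`, for a finite index set `J`: a homomorphism of group schemes `G → GL_J` over `F`, written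
through functors of points. As `GL_J` is the group functor `T ↦ GL_J(Γ(T, 𝒪_T))` on `F`-schemes,
this is a family of group homomorphisms `G(T) → GL_J(Γ(T, 𝒪_T))`, natural in the
`F`-scheme `T`. The group structure on `G(T) = (T ⟶ G)` is the one induced by that of `G`. -/
structure AlgRep {F : Type u} [Field F] (G : Over (Spec (CommRingCat.of F))) [GrpObj G]
    (J : Type) [Fintype J] [DecidableEq J] where
  /-- The homomorphism on `T`-valued points. -/
  toHom : ∀ T : Over (Spec (CommRingCat.of F)), (T ⟶ G) →* GL J Γ(T.left, ⊤)
  naturality : ∀ {S T : Over (Spec (CommRingCat.of F))} (f : S ⟶ T) (g : T ⟶ G),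
    toHom S (f ≫ g) = Matrix.GeneralLinearGroup.map f.left.appTop.hom (toHom T g)

/-- The `k`-th tensor power of a matrix over a commutative ring `R`: the matrix of the operator
`A ⊗ ⋯ ⊗ A` (`k` factors) in the basis `e_{q 1} ⊗ ⋯ ⊗ e_{q k}` of `(R^J)^{⊗ k}`,
indexed by `q : Fin k → J`. -/
def tensorPowMatrix {J R : Type*} [CommRing R] (k : ℕ) (A : Matrix J J R) :
    Matrix (Fin k → J) (Fin k → J) R :=
  Matrix.of fun p q => ∏ i, A (p i) (q i)

/-- `tensorPowMatrix k A` is the matrix of the `k`-th tensor power of the operator `A`. -/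
theorem tensorPowMatrix_eq_toMatrix {J R : Type*} [CommRing R] [Fintype J] [DecidableEq J]
    (k : ℕ) (A : Matrix J J R) :
    tensorPowMatrix k A =
      LinearMap.toMatrix (Basis.piTensorProduct fun _ : Fin k => Pi.basisFun R J)
        (Basis.piTensorProduct fun _ : Fin k => Pi.basisFun R J)
        (PiTensorProduct.map fun _ : Fin k => Matrix.toLin' A) := by
  ext p q
  simp [tensorPowMatrix, LinearMap.toMatrix_apply]

theorem tensorPowMatrix_one {J R : Type*} [CommRing R] [DecidableEq J] (k : ℕ) :
    tensorPowMatrix k (1 : Matrix J J R) = 1 := by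
  ext p q
  by_cases h : p = q
  · subst h
    simp [tensorPowMatrix]
  · obtain ⟨i, hi⟩ := Function.ne_iff.mp h
    rw [Matrix.one_apply_ne h]
    exact Finset.prod_eq_zero (Finset.mem_univ i) (Matrix.one_apply_ne hi)

theorem tensorPowMatrix_mul {J R : Type*} [CommRing R] [Fintype J] (k : ℕ)
    (A B : Matrix J J R) :
    tensorPowMatrix k (A * B) = tensorPowMatrix k A * tensorPowMatrix k B := by
  classical
  ext p q
  simp only [tensorPowMatrix, Matrix.of_apply, Matrix.mul_apply, ← Finset.prod_mul_distrib]
  rw [Finset.prod_univ_sum, Fintype.piFinset_univ]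

/-- The `k`-th tensor power as a group homomorphism `GL_J(R) → GL_{J^k}(R)`. -/
def tensorPowHom (J R : Type*) [CommRing R] [Fintype J] [DecidableEq J] (k : ℕ) :
    GL J R →* GL (Fin k → J) R :=
  Units.map
    { toFun := tensorPowMatrix k
      map_one' := tensorPowMatrix_one k
      map_mul' := tensorPowMatrix_mul k }

namespace AlgRep

variable {F : Type u} [Field F] {G : Over (Spec (CommRingCat.of F))} [GrpObj G]
  {J : Type} [Fintype J] [DecidableEq J]

/-- The `k`-th tensor power `T^k(ρ)` of a representation `ρ`. -/
def tensorPow (k : ℕ) (ρ : AlgRep G J) : AlgRep G (Fin k → J) where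
  toHom T := (tensorPowHom J Γ(T.left, ⊤) k).comp (ρ.toHom T)
  naturality f g := by
    ext p q
    simp [tensorPowHom, tensorPowMatrix, ρ.naturality]

/-- Two representations are isomorphic if they are conjugate by an invertible matrix
over the base field `F`. -/
def Equivalent (ρ₁ ρ₂ : AlgRep G J) : Prop :=
  ∃ P : GL J F, ∀ (T : Over (Spec (CommRingCat.of F))) (g : T ⟶ G),
    Matrix.GeneralLinearGroup.map (scalars T) P * ρ₁.toHom T g =
      ρ₂.toHom T g * Matrix.GeneralLinearGroup.map (scalars T) P

/-- The `Γ(T, 𝒪_T)`-submodule `W_T` of `Γ(T, 𝒪_T)^J` generated by a subspace `W` of `F^J`, that is,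
the image of `Γ(T, 𝒪_T) ⊗_F W` in `Γ(T, 𝒪_T) ⊗_F F^J = Γ(T, 𝒪_T)^J`. -/
def baseChange (W : Submodule F (J → F)) (T : Over (Spec (CommRingCat.of F))) :
    Submodule Γ(T.left, ⊤) (J → Γ(T.left, ⊤)) :=
  Submodule.span Γ(T.left, ⊤) ((fun w i => scalars T (w i)) '' (W : Set (J → F)))

/-- A subspace `W` of `F^J` is a subrepresentation of `ρ` if, for every `F`-scheme `T`, the module
`W_T` is stable under `G(T)`. -/
def IsSubrep (ρ : AlgRep G J) (W : Submodule F (J → F)) : Prop :=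
  ∀ (T : Over (Spec (CommRingCat.of F))) (g : T ⟶ G),
    ∀ v ∈ baseChange W T, (ρ.toHom T g : Matrix J J Γ(T.left, ⊤)) *ᵥ v ∈ baseChange W T

/-- A representation is semisimple if every subrepresentation has a complementary
subrepresentation. -/
def IsSemisimple (ρ : AlgRep G J) : Prop :=
  ∀ W : Submodule F (J → F), ρ.IsSubrep W →
    ∃ W' : Submodule F (J → F), ρ.IsSubrep W' ∧ IsCompl W W'

end AlgRep

end

end AlgGrp

/-! Let χ₁, χ₂ be the characters. The trace of a tensor power is the power of the trace, so χ₁ ^ k =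
χ₂ ^ k. At the identity both characters equal n, and the cofactor of χ₁ - χ₂ in χ₁ ^ k - χ₂ ^ k has
value k n ^ (k - 1) there. For n > 0 this is nonzero in characteristic zero, so χ₁ = χ₂ near the
identity (`locZero_sub_of_pow_eq_pow`).

To turn this local equality into an isomorphism without using smoothness or integrality of G, the
group is replaced by a finite-dimensional algebra. Let m be the maximal ideal of the identity and
apply ρ₁ ⊕ ρ₂ to the infinitesimal neighbourhood defined by m ^ N, with N large. The values span an
algebra E of matrices, and a linear form kills E exactly when its matrix coefficient vanishes near
the identity (`exists_subalgebra`). This rests on Krull's intersection theorem, and on products of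
infinitesimal points being infinitesimal.

The stabilizer of a subspace is a subgroup cut out by matrix coefficients. If these vanish near the
identity, then they vanish on an open and closed set, hence on all of the connected G
(`eq_zero_of_vanishing_near_one`). So E and G stabilize the same subspaces (`stabilizes_iff`): ρ₁
and ρ₂ give semisimple E-modules with equal traces, which are isomorphic in characteristic zero
(`nonempty_linearEquiv_of_trace_eq`). The graph of the isomorphism is E-stable, hence G-stable, so
the isomorphism is G-equivariant. -/

section SemisimpleTrace

/-! ### Semisimple modules over an algebra and their characters -/

variable {F D : Type*} [Field F] [Ring D] [Algebra F D]

theorem trace_lsmul_prod {V W : Type*}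
    [AddCommGroup V] [Module F V] [Module D V] [IsScalarTower F D V] [FiniteDimensional F V]
    [AddCommGroup W] [Module F W] [Module D W] [IsScalarTower F D W] [FiniteDimensional F W]
    (d : D) :
    LinearMap.trace F (V × W) (Algebra.lsmul F F (V × W) d) =
      LinearMap.trace F V (Algebra.lsmul F F V d) + LinearMap.trace F W (Algebra.lsmul F F W d) := by
  rw [← LinearMap.trace_prodMap']
  rfl

theorem trace_lsmul_equiv {V W : Type*}
    [AddCommGroup V] [Module F V] [Module D V] [IsScalarTower F D V]
    [AddCommGroup W] [Module F W] [Module D W] [IsScalarTower F D W]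
    (e : V ≃ₗ[D] W) (d : D) :
    LinearMap.trace F V (Algebra.lsmul F F V d) = LinearMap.trace F W (Algebra.lsmul F F W d) := by
  rw [← LinearMap.trace_conj' (Algebra.lsmul F F V d) (e.restrictScalars F)]
  congr 1
  ext w
  simp [LinearEquiv.conj_apply]

theorem isSemisimpleModule_prod {V W : Type*} [AddCommGroup V] [Module D V]
    [AddCommGroup W] [Module D W] [IsSemisimpleModule D V] [IsSemisimpleModule D W] :
    IsSemisimpleModule D (V × W) := by
  have : IsSemisimpleModule D (⊤ : Submodule D (V × W)) := by
    rw [← LinearMap.sup_range_inl_inr]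
    exact .sup (.range _) (.range _)
  exact .congr Submodule.topEquiv.symm

/-- Two semisimple modules without nonzero homomorphisms in either direction are separated
by an element of the ring. -/
theorem exists_smul_eq_self_and_smul_eq_zero {V W : Type*}
    [AddCommGroup V] [Module F V] [Module D V] [IsScalarTower F D V] [FiniteDimensional F V]
    [AddCommGroup W] [Module F W] [Module D W] [IsScalarTower F D W] [FiniteDimensional F W]
    [IsSemisimpleModule D V] [IsSemisimpleModule D W]
    (hVW : ∀ f : V →ₗ[D] W, f = 0) (hWV : ∀ f : W →ₗ[D] V, f = 0) :
    ∃ d : D, (∀ v : V, d • v = v) ∧ ∀ w : W, d • w = 0 := by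
  classical
  -- The projection onto V commutes with every D-endomorphism because these have no off-diagonal
  -- part. The density theorem then applies to it.
  let p : Module.End (Module.End D (V × W)) (V × W) :=
    { toFun := fun x => (x.1, 0)
      map_add' := by intro x y; simp
      map_smul' := by
        rintro g ⟨v, w⟩
        have h1 : (g (v, 0)).2 = 0 := by
          have := hVW (LinearMap.snd D V W ∘ₗ g ∘ₗ LinearMap.inl D V W)
          simpa using congr($this v)
        have h2 : (g (0, w)).1 = 0 := by
          have := hWV (LinearMap.fst D V W ∘ₗ g ∘ₗ LinearMap.inr D V W)
          simpa using congr($this w)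
        have h3 : g (v, w) = g (v, 0) + g (0, w) := by rw [← map_add]; simp
        simp only [Module.End.smul_def, RingHom.id_apply, h3]
        ext <;> simp [h1, h2] }
  have : IsSemisimpleModule D (V × W) := isSemisimpleModule_prod
  let b := Module.finBasis F (V × W)
  obtain ⟨d, hd⟩ := jacobson_density p (Finset.univ.image b)
  have key : ∀ x : V × W, ((x.1, 0) : V × W) = d • x := by
    have : (LinearMap.inl F V W ∘ₗ LinearMap.fst F V W) = Algebra.lsmul F F (V × W) d :=
      b.ext fun i => hd (b i) (by simp)
    exact fun x => congr($this x)
  exact ⟨d, fun v => by simpa using congr(($(key (v, 0))).1).symm,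
    fun w => by simpa using congr(($(key (0, w))).2).symm⟩

/-- A finite-dimensional semisimple module over an algebra over a field of characteristic zero is
determined by its character. -/
theorem nonempty_linearEquiv_of_trace_eq [CharZero F] {V W : Type u}
    [AddCommGroup V] [Module F V] [Module D V] [IsScalarTower F D V] [FiniteDimensional F V]
    [AddCommGroup W] [Module F W] [Module D W] [IsScalarTower F D W] [FiniteDimensional F W]
    [IsSemisimpleModule D V] [IsSemisimpleModule D W]
    (h : ∀ d : D, LinearMap.trace F V (Algebra.lsmul F F V d) =
      LinearMap.trace F W (Algebra.lsmul F F W d)) :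
    Nonempty (V ≃ₗ[D] W) := by
  induction hn : Module.finrank F V using Nat.strong_induction_on generalizing V W with
  | _ n ih =>
  have hdim : Module.finrank F V = Module.finrank F W := by
    have := h 1
    simpa using this
  -- A nonzero f splits V as ker f ⊕ C and W as range f ⊕ C', with C ≅ range f. Cancelling the
  -- common trace leaves ker f and C', to which induction applies.
  have split : ∀ {V W : Type u}
      [AddCommGroup V] [Module F V] [Module D V] [IsScalarTower F D V] [FiniteDimensional F V]
      [AddCommGroup W] [Module F W] [Module D W] [IsScalarTower F D W] [FiniteDimensional F W]
      [IsSemisimpleModule D V] [IsSemisimpleModule D W]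
      (_ : ∀ d : D, LinearMap.trace F V (Algebra.lsmul F F V d) =
        LinearMap.trace F W (Algebra.lsmul F F W d)) (_ : Module.finrank F V = n)
      (f : V →ₗ[D] W), f ≠ 0 → Nonempty (V ≃ₗ[D] W) := by
    intro V W _ _ _ _ _ _ _ _ _ _ _ _ h hn f hf
    obtain ⟨C, hC⟩ := exists_isCompl (LinearMap.ker f)
    obtain ⟨C', hC'⟩ := exists_isCompl (LinearMap.range f)
    have e₁ : C ≃ₗ[D] LinearMap.range f :=
      (Submodule.quotientEquivOfIsCompl _ _ hC).symm ≪≫ₗ f.quotKerEquivRange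
    have eV := Submodule.prodEquivOfIsCompl _ _ hC
    have eW := Submodule.prodEquivOfIsCompl _ _ hC'
    have : FiniteDimensional F (LinearMap.ker f) :=
      inferInstanceAs (FiniteDimensional F ((LinearMap.ker f).restrictScalars F))
    have : FiniteDimensional F (LinearMap.range f) :=
      inferInstanceAs (FiniteDimensional F ((LinearMap.range f).restrictScalars F))
    have : FiniteDimensional F C :=
      inferInstanceAs (FiniteDimensional F (C.restrictScalars F))
    have : FiniteDimensional F C' :=
      inferInstanceAs (FiniteDimensional F (C'.restrictScalars F))
    have hlt : Module.finrank F (LinearMap.ker f) < n := by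
      rw [← hn]
      refine Submodule.finrank_lt (s := (LinearMap.ker f).restrictScalars F) fun htop => hf ?_
      rw [← LinearMap.ker_eq_top]
      exact Submodule.restrictScalars_injective F D V htop
    obtain ⟨e₂⟩ := ih _ hlt (V := LinearMap.ker f) (W := C') (fun d => by
      have := h d
      rw [← trace_lsmul_equiv eV, ← trace_lsmul_equiv eW, trace_lsmul_prod, trace_lsmul_prod,
        trace_lsmul_equiv e₁, add_comm] at this
      exact add_left_cancel this) rfl
    exact ⟨eV.symm ≪≫ₗ e₂.prodCongr e₁ ≪≫ₗ LinearEquiv.prodComm D _ _ ≪≫ₗ eW⟩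
  by_cases hVW : ∀ f : V →ₗ[D] W, f = 0
  · by_cases hWV : ∀ f : W →ₗ[D] V, f = 0
    · obtain ⟨d, hd₁, hd₂⟩ := exists_smul_eq_self_and_smul_eq_zero (F := F) hVW hWV
      have h₁ : Algebra.lsmul F F V d = LinearMap.id := LinearMap.ext hd₁
      have h₂ : Algebra.lsmul F F W d = 0 := LinearMap.ext hd₂
      -- This d has trace dim V on V and 0 on W, so dim V = 0 by characteristic zero.
      have h₀ := h d
      rw [h₁, h₂, LinearMap.trace_id, map_zero, Nat.cast_eq_zero] at h₀
      have := Module.finrank_zero_iff.mp h₀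
      have := Module.finrank_zero_iff.mp (hdim ▸ h₀)
      exact ⟨0⟩
    · push Not at hWV
      obtain ⟨f, hf⟩ := hWV
      obtain ⟨e⟩ := split (fun d => (h d).symm) (hdim ▸ hn) f hf
      exact ⟨e.symm⟩
  · push Not at hVW
    obtain ⟨f, hf⟩ := hVW
    exact split h hn f hf

/-- The space `F^J` with the action of `D` given by a matrix representation. -/
def MatrixModule {J : Type*} [Fintype J] [DecidableEq J] (_ : D →ₐ[F] Matrix J J F) : Type _ :=
  J → F

namespace MatrixModule

variable {J : Type*} [Fintype J] [DecidableEq J] (α : D →ₐ[F] Matrix J J F)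

instance : AddCommGroup (MatrixModule α) := inferInstanceAs (AddCommGroup (J → F))

instance : Module F (MatrixModule α) := inferInstanceAs (Module F (J → F))

instance : FiniteDimensional F (MatrixModule α) := inferInstanceAs (FiniteDimensional F (J → F))

noncomputable instance : Module D (MatrixModule α) :=
  Module.compHom (J → F) ((Matrix.toLinAlgEquiv' : _ ≃ₐ[F] _).toAlgHom.comp α).toRingHom

theorem smul_def (d : D) (v : MatrixModule α) :
    d • v = Matrix.mulVec (α d) (show J → F from v) := rfl

instance : IsScalarTower F D (MatrixModule α) :=
  ⟨fun a d v => by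
    rw [smul_def, smul_def, map_smul]
    exact Matrix.smul_mulVec a (α d) v⟩

theorem trace_lsmul (d : D) :
    LinearMap.trace F (MatrixModule α) (Algebra.lsmul F F _ d) = (α d).trace := by
  rw [← Matrix.trace_toLin'_eq]
  rfl

theorem isSemisimpleModule
    (h : ∀ W : Submodule F (J → F), (∀ d, ∀ v ∈ W, Matrix.mulVec (α d) v ∈ W) →
      ∃ W' : Submodule F (J → F), (∀ d, ∀ v ∈ W', Matrix.mulVec (α d) v ∈ W') ∧ IsCompl W W') :
    IsSemisimpleModule D (MatrixModule α) := by
  refine (isSemisimpleModule_iff _ _).mpr ⟨fun W => ?_⟩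
  let W₀ : Submodule F (J → F) :=
    { carrier := {v | (show MatrixModule α from v) ∈ W}
      add_mem' := W.add_mem
      zero_mem' := W.zero_mem
      smul_mem' := fun a v hv => (W.restrictScalars F).smul_mem a hv }
  obtain ⟨W', hW', hc⟩ := h W₀ fun d v hv => W.smul_mem d hv
  let W₁ : Submodule D (MatrixModule α) :=
    { carrier := {v | (show J → F from v) ∈ W'}
      add_mem' := W'.add_mem
      zero_mem' := W'.zero_mem
      smul_mem' := fun d v hv => hW' d v hv }
  rw [isCompl_iff, Submodule.disjoint_def, codisjoint_iff, Submodule.eq_top_iff'] at hc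
  refine ⟨W₁, ?_⟩
  rw [isCompl_iff, Submodule.disjoint_def, codisjoint_iff, Submodule.eq_top_iff']
  refine ⟨hc.1, fun v => ?_⟩
  obtain ⟨x, hx, y, hy, rfl⟩ := Submodule.mem_sup.mp (hc.2 v)
  exact Submodule.mem_sup.mpr ⟨x, hx, y, hy, rfl⟩

end MatrixModule

/-- Semisimple matrix representations of an algebra over a field of characteristic zero
with the same character are conjugate. -/
theorem exists_GL_conj_of_trace_eq [CharZero F] {J : Type*} [Fintype J] [DecidableEq J]
    (α β : D →ₐ[F] Matrix J J F) [IsSemisimpleModule D (MatrixModule α)]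
    [IsSemisimpleModule D (MatrixModule β)] (h : ∀ d, (α d).trace = (β d).trace) :
    ∃ P : GL J F, ∀ d, (P : Matrix J J F) * α d = β d * P := by
  obtain ⟨e⟩ := nonempty_linearEquiv_of_trace_eq (F := F) (D := D)
    (V := MatrixModule α) (W := MatrixModule β)
    (fun d => by rw [MatrixModule.trace_lsmul, MatrixModule.trace_lsmul, h])
  let e' : (J → F) ≃ₗ[F] (J → F) := e.restrictScalars F
  refine ⟨Units.map (LinearMap.toMatrixAlgEquiv' : _ ≃ₐ[F] Matrix J J F).toMonoidHom
    (LinearMap.GeneralLinearGroup.generalLinearEquiv F _ |>.symm e'), fun d => ?_⟩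
  apply Matrix.toLin'.injective
  refine LinearMap.ext fun v => ?_
  rw [Matrix.toLin'_mul, Matrix.toLin'_mul]
  have h₁ : Matrix.toLin' (LinearMap.toMatrix' (e' : (J → F) →ₗ[F] (J → F))) = e' :=
    Matrix.toLin'_toMatrix' _
  change Matrix.toLin' (LinearMap.toMatrix' (e' : (J → F) →ₗ[F] (J → F)))
    (Matrix.toLin' (α d) v) = Matrix.toLin' (β d)
      (Matrix.toLin' (LinearMap.toMatrix' (e' : (J → F) →ₗ[F] (J → F))) v)
  rw [h₁]
  exact e.map_smul d v

end SemisimpleTrace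

/-! ### Vanishing of functions on a connected group scheme -/

section Geometry

open MonoidalCategory CartesianMonoidalCategory MonObj

/-- The family `S` of global functions pulls back to zero along `g`. -/
def KillsPullback {X T : Scheme.{u}} (S : Set Γ(X, ⊤)) (g : T ⟶ X) : Prop :=
  ∀ f ∈ S, g.appTop.hom f = 0

/-- The largest open subset on which all functions in `S` vanish. -/
def vanishingOpens {X : Scheme.{u}} (S : Set Γ(X, ⊤)) : X.Opens :=
  sSup {U | ∀ f ∈ S, X.presheaf.map (homOfLE le_top : U ⟶ ⊤).op f = 0}

theorem killsPullback_of_range_subset {X T : Scheme.{u}} {S : Set Γ(X, ⊤)} (g : T ⟶ X)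
    (hg : Set.range g ⊆ vanishingOpens S) : KillsPullback S g := by
  intro f hf
  refine TopCat.Presheaf.section_ext T.sheaf _ _ _ fun t ht => ?_
  obtain ⟨U, hU, hxU⟩ := TopologicalSpace.Opens.mem_sSup.mp (hg ⟨t, rfl⟩)
  have h₁ : X.presheaf.germ ⊤ (g t) trivial f = 0 := by
    rw [← X.presheaf.germ_res_apply (homOfLE le_top : U ⟶ ⊤) (g t) hxU f]
    rw [hU f hf, map_zero]
  have := Scheme.Hom.germ_stalkMap_apply g ⊤ t trivial f
  rw [h₁, map_zero] at this
  erw [map_zero]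
  exact this.symm

theorem Flat.stalkMap_injective {X Y : Scheme.{u}} (g : Y ⟶ X) [Flat g] (y : Y) :
    Function.Injective (g.stalkMap y).hom := by
  algebraize [(g.stalkMap y).hom]
  have : Module.FaithfullyFlat (X.presheaf.stalk (g y)) (Y.presheaf.stalk y) :=
    @Module.FaithfullyFlat.of_flat_of_isLocalHom _ _ _ _ _ _ _
      (Flat.stalkMap g y) (g.toLRSHom.prop y)
  exact FaithfulSMul.algebraMap_injective _ _

/-- Stalk maps of a flat morphism are injective, so a zero pullback forces zero germs along the
image, which is open. With `killsPullback_of_range_subset`, this lets membership in `vanishingOpens`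
be tested on T-valued points. -/
theorem range_subset_of_killsPullback {X T : Scheme.{u}} {S : Set Γ(X, ⊤)} (g : T ⟶ X)
    [Flat g] [UniversallyOpen g] (h : KillsPullback S g) :
    Set.range g ⊆ vanishingOpens S := by
  let U : X.Opens := ⟨Set.range g, g.isOpenMap.isOpen_range⟩
  suffices h : U ≤ vanishingOpens S from h
  refine le_sSup fun f hf => ?_
  refine TopCat.Presheaf.section_ext X.sheaf _ _ _ ?_
  rintro _ ⟨t, rfl⟩
  erw [map_zero, X.presheaf.germ_res_apply]
  apply Flat.stalkMap_injective g t
  refine (Scheme.Hom.germ_stalkMap_apply g ⊤ t trivial f).trans ?_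
  refine ((congrArg _ (h f hf)).trans (map_zero _)).trans (map_zero _).symm

theorem eq_zero_of_vanishingOpens_eq_top {X : Scheme.{u}} {S : Set Γ(X, ⊤)}
    (h : vanishingOpens S = ⊤) : ∀ f ∈ S, f = 0 := by
  intro f hf
  simpa using killsPullback_of_range_subset (S := S) (𝟙 X) (by simp [h]) f hf

variable {F : Type u} [Field F] (G : Over (Spec (CommRingCat.of F))) [GrpObj G]

/-- The automorphism `(a, b) ↦ (a / b, b)` of `G × G`. -/
noncomputable def shearIso : G ⊗ G ≅ G ⊗ G where
  hom := lift (fst G G / snd G G) (snd G G)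
  inv := lift (fst G G * snd G G) (snd G G)
  hom_inv_id := by
    ext1 <;> simp [MonObj.comp_mul]
  inv_hom_id := by
    ext1 <;> simp [GrpObj.comp_div]

/-- The automorphism `(t, b) ↦ (t, g(t) b)` of `K × G` given by a `K`-point `g` of `G`. -/
noncomputable def translationIso {K : Over (Spec (CommRingCat.of F))} (g : K ⟶ G) : K ⊗ G ≅ K ⊗ G where
  hom := lift (fst K G) ((fst K G ≫ g) * snd K G)
  inv := lift (fst K G) ((fst K G ≫ g)⁻¹ * snd K G)
  hom_inv_id := by
    ext1 <;> simp [MonObj.comp_mul, GrpObj.comp_inv]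
  inv_hom_id := by
    ext1 <;> simp [MonObj.comp_mul]

theorem flat_fst_left (X Y : Over (Spec (CommRingCat.of F))) : Flat (fst X Y).left := by
  dsimp; infer_instance

theorem universallyOpen_fst_left (X Y : Over (Spec (CommRingCat.of F))) :
    UniversallyOpen (fst X Y).left := by
  dsimp; infer_instance

theorem universallyOpen_snd_left (X Y : Over (Spec (CommRingCat.of F))) :
    UniversallyOpen (snd X Y).left := by
  dsimp; infer_instance

variable {G}

/-- Let `S` be a family of global functions on a connected group scheme over a field whose common
zero locus is a subgroup. If all of them vanish near the identity, they vanish everywhere. -/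
theorem eq_zero_of_vanishing_near_one [ConnectedSpace G.left] (S : Set Γ(G.left, ⊤))
    (hdiv : ∀ (T : Over (Spec (CommRingCat.of F))) (a b : T ⟶ G),
      KillsPullback S a.left → KillsPullback S b.left → KillsPullback S (a / b).left)
    (hone : Set.range η[G].left ⊆ vanishingOpens S) : ∀ f ∈ S, f = 0 := by
  apply eq_zero_of_vanishingOpens_eq_top
  set Ω := vanishingOpens S with hΩ
  have : IsIso (shearIso G).hom.left :=
    inferInstanceAs (IsIso ((Over.forget _).map (shearIso G).hom))
  -- `Ω` is stable under division.
  have hdivΩ : ∀ w : (G ⊗ G).left, (fst G G).left w ∈ Ω → (snd G G).left w ∈ Ω →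
      (fst G G / snd G G).left w ∈ Ω := by
    intro w h₁ h₂
    let W : (G ⊗ G).left.Opens := (fst G G).left ⁻¹ᵁ Ω ⊓ (snd G G).left ⁻¹ᵁ Ω
    let T : Over (Spec (CommRingCat.of F)) := Over.mk (W.ι ≫ (G ⊗ G).hom)
    let i : T ⟶ G ⊗ G := Over.homMk W.ι rfl
    have hi : i.left = W.ι := rfl
    -- Division is a projection up to an automorphism, hence flat and universally open.
    have e : fst G G / snd G G = (shearIso G).hom ≫ fst G G := by simp [shearIso]
    have := flat_fst_left G G
    have := universallyOpen_fst_left G G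
    have hF : Flat (i ≫ (fst G G / snd G G)).left := by
      rw [e, Over.comp_left, Over.comp_left, hi]; infer_instance
    have hO : UniversallyOpen (i ≫ (fst G G / snd G G)).left := by
      rw [e, Over.comp_left, Over.comp_left, hi]
      have : UniversallyOpen ((shearIso G).hom.left ≫ (fst G G).left) :=
        MorphismProperty.comp_mem _ _ _ inferInstance inferInstance
      exact MorphismProperty.comp_mem _ _ _ inferInstance this
    have hk : KillsPullback S (i ≫ (fst G G / snd G G)).left := by
      rw [GrpObj.comp_div]
      refine hdiv _ _ _ (killsPullback_of_range_subset _ ?_) (killsPullback_of_range_subset _ ?_)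
      · rintro _ ⟨x, rfl⟩
        rw [Over.comp_left, hi]
        exact x.2.1
      · rintro _ ⟨x, rfl⟩
        rw [Over.comp_left, hi]
        exact x.2.2
    have := range_subset_of_killsPullback _ hk ⟨⟨w, h₁, h₂⟩, rfl⟩
    rwa [Over.comp_left, hi] at this
  -- An open subgroup is closed: for z in the closure, zΩ is an open neighbourhood of z, so it meets
  -- Ω, and dividing returns z to Ω. As z need not be rational, the translation is carried out over
  -- its residue field.
  have hclosed : IsClosed (Ω : Set G.left) := by
    refine isClosed_of_closure_subset fun z hz => ?_
    let K : Over (Spec (CommRingCat.of F)) := Over.mk (G.left.fromSpecResidueField z ≫ G.hom)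
    let zp : K ⟶ G := Over.homMk (G.left.fromSpecResidueField z) rfl
    have hzp : ∀ s, zp.left s = z := fun s => Scheme.fromSpecResidueField_apply z s
    let r : K ⊗ G ⟶ G := (fst K G ≫ zp) * snd K G
    have : IsIso (translationIso G zp).hom.left :=
      inferInstanceAs (IsIso ((Over.forget _).map (translationIso G zp).hom))
    have hr : r = (translationIso G zp).hom ≫ snd K G := by simp [r, translationIso]
    have := universallyOpen_snd_left K G
    have hO : UniversallyOpen r.left := by
      rw [hr, Over.comp_left]
      exact MorphismProperty.comp_mem _ _ _ inferInstance inferInstance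
    let V : (K ⊗ G).left.Opens := (snd K G).left ⁻¹ᵁ Ω
    have hV : IsOpen (r.left '' V) := r.left.isOpenMap _ V.2
    have hzV : z ∈ r.left '' V := by
      let q : K ⟶ K ⊗ G := lift (𝟙 K) (toUnit K ≫ η[G])
      have hq : q ≫ snd K G = toUnit K ≫ η[G] := lift_snd _ _
      have hqr : q ≫ r = zp := by
        rw [MonObj.comp_mul, hq, ← Hom.one_def, _root_.mul_one, ← Category.assoc, lift_fst,
          Category.id_comp]
      obtain ⟨s⟩ : Nonempty K.left :=
        inferInstanceAs (Nonempty (Spec (G.left.residueField z)))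
      refine ⟨q.left s, hone ?_, ?_⟩
      · rw [← Scheme.Hom.comp_apply, ← Over.comp_left, hq, Over.comp_left]
        exact ⟨_, rfl⟩
      · rw [← Scheme.Hom.comp_apply, ← Over.comp_left, hqr, hzp]
    obtain ⟨_, ⟨y, hy, rfl⟩, hyΩ⟩ := mem_closure_iff.mp hz _ hV hzV
    have h := hdivΩ ((lift r (snd K G)).left y) (by
      rw [← Scheme.Hom.comp_apply, ← Over.comp_left, lift_fst]; exact hyΩ) (by
      rw [← Scheme.Hom.comp_apply, ← Over.comp_left, lift_snd]; exact hy)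
    rw [← Scheme.Hom.comp_apply, ← Over.comp_left, GrpObj.comp_div, lift_fst, lift_snd,
      mul_div_cancel_right, Over.comp_left, Scheme.Hom.comp_apply, hzp] at h
    exact h
  have huniv := IsClopen.eq_univ ⟨hclosed, Ω.2⟩
    ⟨η[G].left (IsLocalRing.closedPoint F), hone ⟨_, rfl⟩⟩
  exact TopologicalSpace.Opens.ext huniv

end Geometry

/-! ### Affine points and infinitesimal points at the identity -/

namespace AlgGrp

open scoped MonObj Matrix TensorProduct
open CartesianMonoidalCategory

noncomputable section

variable {F : Type u} [Field F]

/-- The spectrum of an `F`-algebra as an `F`-scheme. -/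
abbrev specOver (F : Type u) [Field F] (R : Type u) [CommRing R] [Algebra F R] :
    Over (Spec (CommRingCat.of F)) :=
  Over.mk (Spec.map (CommRingCat.ofHom (algebraMap F R)))

variable {R R' : Type u} [CommRing R] [Algebra F R] [CommRing R'] [Algebra F R']

/-- The morphism of `F`-schemes induced by a homomorphism of `F`-algebras. -/
def specOverMap (f : R →ₐ[F] R') : specOver F R' ⟶ specOver F R :=
  Over.homMk (Spec.map (CommRingCat.ofHom f.toRingHom)) (by
    dsimp [specOver]
    rw [← Spec.map_comp, ← CommRingCat.ofHom_comp]
    congr 2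
    exact f.comp_algebraMap)

theorem specOverMap_comp {R'' : Type u} [CommRing R''] [Algebra F R'']
    (g : R' →ₐ[F] R'') (f : R →ₐ[F] R') :
    specOverMap (g.comp f) = specOverMap g ≫ specOverMap f := by
  ext1
  rw [Over.comp_left]
  exact Spec.map_comp (CommRingCat.ofHom f.toRingHom) (CommRingCat.ofHom g.toRingHom)

theorem specOverMap_injective :
    Function.Injective (specOverMap : (R →ₐ[F] R') → (specOver F R' ⟶ specOver F R)) := by
  intro f g h
  have := Spec.map_injective congr(($h).left)
  ext r
  exact congr($this r)

variable {G : Over (Spec (CommRingCat.of F))}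

/-- Pullback of global functions along an `R`-valued point. -/
def pull (g : specOver F R ⟶ G) : Γ(G.left, ⊤) →+* R :=
  (Scheme.ΓSpecIso (CommRingCat.of R)).hom.hom.comp g.left.appTop.hom

theorem pull_specOverMap_comp (f : R →ₐ[F] R') (g : specOver F R ⟶ G) :
    pull (specOverMap f ≫ g) = f.toRingHom.comp (pull g) := by
  ext a
  have := Scheme.ΓSpecIso_naturality (CommRingCat.ofHom f.toRingHom)
  have := congr($this (g.left.appTop a))
  simp only [pull, Over.comp_left, RingHom.comp_apply]
  rw [Scheme.Hom.comp_appTop]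
  exact this

theorem appTop_scalars {T S : Over (Spec (CommRingCat.of F))} (g : T ⟶ S) (a : F) :
    g.left.appTop.hom (scalars S a) = scalars T a := by
  have h : (g.left ≫ S.hom).appTop = T.hom.appTop := by rw [Over.w]
  rw [Scheme.Hom.comp_appTop] at h
  exact congr($h ((Scheme.ΓSpecIso (CommRingCat.of F)).inv a))

theorem pull_scalars (g : specOver F R ⟶ G) (a : F) :
    pull g (scalars G a) = algebraMap F R a := by
  have h := Scheme.ΓSpecIso_naturality (CommRingCat.ofHom (algebraMap F R))
  have h := congr($h ((Scheme.ΓSpecIso (CommRingCat.of F)).inv a))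
  refine (congrArg (Scheme.ΓSpecIso (CommRingCat.of R)).hom.hom (appTop_scalars g a)).trans ?_
  refine Eq.trans h ?_
  simp

variable [GrpObj G]

/-- A global function vanishes near the identity, in terms of an affine neighbourhood. -/
def LocZero {A : Type u} [CommRing A] [Algebra F A] (j : specOver F A ⟶ G) (ε : A →ₐ[F] F)
    (f : Γ(G.left, ⊤)) : Prop :=
  ∃ s : A, ε s ≠ 0 ∧ s * pull j f = 0

/-- The finite type hypothesis enters here, to make A noetherian for Krull's intersection theorem.
-/
theorem exists_affine_nhd_one (G : Over (Spec (CommRingCat.of F))) [GrpObj G]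
    [LocallyOfFiniteType G.hom] :
    ∃ (A : Type u) (_ : CommRing A) (_ : Algebra F A) (j : specOver F A ⟶ G) (ε : A →ₐ[F] F),
      IsNoetherianRing A ∧ IsOpenImmersion j.left ∧ specOverMap ε ≫ j = 1 := by
  let u : specOver F F ⟶ G := 1
  obtain ⟨U, hU, hxU, -⟩ := exists_isAffineOpen_mem_and_subset
    (x := u.left (IsLocalRing.closedPoint F)) (U := ⊤) trivial
  let φ : CommRingCat.of F ⟶ Γ(G.left, U) := Spec.preimage (hU.fromSpec ≫ G.hom)
  have hφ : Spec.map φ = hU.fromSpec ≫ G.hom := Spec.map_preimage _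
  let : Algebra F Γ(G.left, U) := φ.hom.toAlgebra
  let j : specOver F Γ(G.left, U) ⟶ G := Over.homMk hU.fromSpec hφ.symm
  have hrange : Set.range u.left ⊆ Set.range hU.fromSpec := by
    rintro _ ⟨x, rfl⟩
    rw [hU.range_fromSpec]
    rwa [Subsingleton.elim (α := PrimeSpectrum F) x (IsLocalRing.closedPoint F)]
  let ψ : Γ(G.left, U) ⟶ CommRingCat.of F :=
    Spec.preimage (IsOpenImmersion.lift hU.fromSpec u.left hrange)
  have hψ : Spec.map ψ ≫ hU.fromSpec = u.left := by
    rw [Spec.map_preimage, IsOpenImmersion.lift_fac]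
  let ε : Γ(G.left, U) →ₐ[F] F :=
    { ψ.hom with
      commutes' := fun a => by
        have h : φ ≫ ψ = CommRingCat.ofHom (algebraMap F F) := by
          apply Spec.map_injective
          rw [Spec.map_comp, hφ, ← Category.assoc, hψ]
          exact Over.w u
        exact congr($h a) }
  refine ⟨Γ(G.left, U), inferInstance, inferInstance, j, ε, ?_, ?_, ?_⟩
  · have : LocallyOfFiniteType (Spec.map φ) := by rw [hφ]; infer_instance
    have : φ.hom.FiniteType := (HasRingHomProperty.Spec_iff (P := @LocallyOfFiniteType)).mp this
    have : Algebra.FiniteType F Γ(G.left, U) := this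
    exact Algebra.FiniteType.isNoetherianRing F _
  · exact inferInstanceAs (IsOpenImmersion hU.fromSpec)
  · ext1
    exact hψ

section Infinitesimal

variable {A : Type u} [CommRing A] [Algebra F A] {j : specOver F A ⟶ G} {ε : A →ₐ[F] F}

/-- A point of `G` is infinitesimal if it is trivial on all field-valued points of its source. -/
def IsInfinitesimal (y : specOver F R ⟶ G) : Prop :=
  ∀ (K : Type u) [Field K] [Algebra F K] (κ : R →ₐ[F] K), specOverMap κ ≫ y = 1

theorem specOverMap_comp_one (f : R →ₐ[F] R') : specOverMap f ≫ (1 : specOver F R ⟶ G) = 1 :=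
  MonObj.comp_one _

theorem IsInfinitesimal.comp {y : specOver F R ⟶ G} (hy : IsInfinitesimal y) (f : R →ₐ[F] R') :
    IsInfinitesimal (specOverMap f ≫ y) := by
  intro K _ _ κ
  rw [← Category.assoc, ← specOverMap_comp]
  exact hy K _

theorem IsInfinitesimal.mul {x y : specOver F R ⟶ G} (hx : IsInfinitesimal x)
    (hy : IsInfinitesimal y) : IsInfinitesimal (x * y) := by
  intro K _ _ κ
  rw [MonObj.comp_mul, hx K κ, hy K κ, mul_one]

/-- A homomorphism to a field kills the nilpotent classes of a - ε a, so it factors through ε. -/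
theorem isInfinitesimal_quotient_pow (hj : specOverMap ε ≫ j = 1) (N : ℕ) :
    IsInfinitesimal (specOverMap (Ideal.Quotient.mkₐ F (RingHom.ker ε ^ N)) ≫ j) := by
  intro K _ _ κ
  have h : κ.comp (Ideal.Quotient.mkₐ F (RingHom.ker ε ^ N)) = (Algebra.ofId F K).comp ε := by
    ext a
    have hm : a - algebraMap F A (ε a) ∈ RingHom.ker ε := by simp [RingHom.mem_ker]
    have hp : (κ (Ideal.Quotient.mkₐ F (RingHom.ker ε ^ N) (a - algebraMap F A (ε a)))) ^ N = 0 := by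
      rw [← map_pow, ← map_pow]
      have : Ideal.Quotient.mkₐ F (RingHom.ker ε ^ N) ((a - algebraMap F A (ε a)) ^ N) = 0 :=
        Ideal.Quotient.eq_zero_iff_mem.mpr (Ideal.pow_mem_pow hm N)
      rw [this, map_zero]
    have h0 := eq_zero_of_pow_eq_zero hp
    rw [map_sub, map_sub, sub_eq_zero] at h0
    rw [AlgHom.comp_apply, h0, AlgHom.commutes, AlgHom.commutes]
    rfl
  rw [← Category.assoc, ← specOverMap_comp, h, specOverMap_comp, Category.assoc, hj,
    specOverMap_comp_one]

/-- Testing on residue fields shows that y maps every point of Spec R to the identity, hence into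
the open image of j. Modulo each maximal ideal, α reduces to ε, so α s lies in no maximal ideal when
ε s ≠ 0. -/
theorem IsInfinitesimal.exists_factor [IsOpenImmersion j.left] (hj : specOverMap ε ≫ j = 1)
    {y : specOver F R ⟶ G} (hy : IsInfinitesimal y) :
    ∃ α : A →ₐ[F] R, y = specOverMap α ≫ j ∧ ∀ s, ε s ≠ 0 → IsUnit (α s) := by
  have hone : ∀ (K : Type u) [Field K] [Algebra F K],
      (1 : specOver F K ⟶ G) = specOverMap ((Algebra.ofId F K).comp ε) ≫ j := by
    intro K _ _
    rw [specOverMap_comp, Category.assoc, hj, specOverMap_comp_one]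
  have hrange : Set.range y.left ⊆ Set.range j.left := by
    rintro _ ⟨p, rfl⟩
    let q : PrimeSpectrum R := p
    let κ : R →ₐ[F] q.asIdeal.ResidueField := IsScalarTower.toAlgHom F R _
    have h := (hy _ κ).trans (hone _)
    obtain ⟨t, ht⟩ : ∃ t, (specOverMap κ).left t = p :=
      ⟨(⊥ : PrimeSpectrum q.asIdeal.ResidueField), PrimeSpectrum.ext (by
        change Ideal.comap (algebraMap R q.asIdeal.ResidueField) ⊥ = q.asIdeal
        rw [← RingHom.ker_eq_comap_bot, Ideal.ker_algebraMap_residueField])⟩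
    rw [← ht, ← Scheme.Hom.comp_apply, ← Over.comp_left, h, Over.comp_left,
      Scheme.Hom.comp_apply]
    exact ⟨_, rfl⟩
  let l₀ : (specOver F R).left ⟶ (specOver F A).left := IsOpenImmersion.lift j.left y.left hrange
  let l : Spec (CommRingCat.of R) ⟶ Spec (CommRingCat.of A) := l₀
  have hl : l ≫ j.left = y.left := IsOpenImmersion.lift_fac _ _ _
  let ψ : CommRingCat.of A ⟶ CommRingCat.of R := Spec.preimage l
  have hψ : Spec.map ψ = l := Spec.map_preimage _
  let α : A →ₐ[F] R :=
    { ψ.hom with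
      commutes' := fun a => by
        have h : CommRingCat.ofHom (algebraMap F A) ≫ ψ = CommRingCat.ofHom (algebraMap F R) := by
          apply Spec.map_injective
          rw [Spec.map_comp, hψ]
          have h₁ : j.left ≫ G.hom = Spec.map (CommRingCat.ofHom (algebraMap F A)) := Over.w j
          have h₂ : y.left ≫ G.hom = Spec.map (CommRingCat.ofHom (algebraMap F R)) := Over.w y
          rw [← h₁, ← h₂, ← hl, Category.assoc]
        exact congr($h a) }
  have hα : y = specOverMap α ≫ j := by
    ext1
    rw [Over.comp_left, ← hl, ← hψ]
    rfl
  refine ⟨α, hα, fun s hs => ?_⟩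
  by_contra hu
  obtain ⟨m, hm, hsm⟩ := exists_max_ideal_of_mem_nonunits hu
  let : Field (R ⧸ m) := Ideal.Quotient.field m
  have h := (hy (R ⧸ m) (Ideal.Quotient.mkₐ F m)).symm.trans (by rw [hα])
  rw [hone, ← Category.assoc, ← specOverMap_comp] at h
  have hmono : Mono j :=
    (Over.forget _).mono_of_mono_map (inferInstanceAs (Mono j.left))
  have h := specOverMap_injective ((cancel_mono j).mp h)
  have h := congr($h s)
  have h0 : Ideal.Quotient.mkₐ F m (α s) = 0 := Ideal.Quotient.eq_zero_iff_mem.mpr hsm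
  rw [AlgHom.comp_apply, AlgHom.comp_apply, h0] at h
  exact hs ((map_eq_zero _).mp h)

theorem IsInfinitesimal.pull_eq_zero [IsOpenImmersion j.left] (hj : specOverMap ε ≫ j = 1)
    {y : specOver F R ⟶ G} (hy : IsInfinitesimal y) {f : Γ(G.left, ⊤)} (hf : LocZero j ε f) :
    pull y f = 0 := by
  obtain ⟨α, rfl, hα⟩ := hy.exists_factor hj
  obtain ⟨s, hs, h⟩ := hf
  rw [pull_specOverMap_comp]
  refine (hα s hs).mul_right_eq_zero.mp ?_
  have := congr(α $h)
  rwa [map_mul, map_zero] at this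

/-- Functions vanishing near the identity in terms of an affine neighbourhood do so on an open
subset. -/
theorem range_one_subset_vanishingOpens [IsOpenImmersion j.left] (hj : specOverMap ε ≫ j = 1)
    (S : Set Γ(G.left, ⊤)) (s : A) (hs : ε s ≠ 0) (hS : ∀ f ∈ S, s * pull j f = 0) :
    Set.range η[G].left ⊆ vanishingOpens S := by
  -- All of S vanishes on the basic open set of s, which contains the identity because ε s ≠ 0.
  let B := Localization.Away s
  let b : A →ₐ[F] B := IsScalarTower.toAlgHom F A B
  have hb : IsOpenImmersion (specOverMap b).left :=
    inferInstanceAs (IsOpenImmersion (Spec.map (CommRingCat.ofHom (algebraMap A (Localization.Away s)))))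
  have hk : KillsPullback S (specOverMap b ≫ j).left := by
    intro f hf
    have h : pull (specOverMap b ≫ j) f = 0 := by
      rw [pull_specOverMap_comp]
      refine (IsLocalization.Away.algebraMap_isUnit s).mul_right_eq_zero.mp ?_
      have := congr(b $(hS f hf))
      rwa [map_mul, map_zero] at this
    exact (map_eq_zero_iff _ (Scheme.ΓSpecIso (CommRingCat.of B)).commRingCatIsoToRingEquiv.injective).mp h
  have hO : IsOpenImmersion (specOverMap b ≫ j).left := by
    rw [Over.comp_left]; infer_instance
  refine subset_trans ?_ (range_subset_of_killsPullback _ hk)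
  let e : B →ₐ[F] F := IsLocalization.liftAlgHom (M := Submonoid.powers s) (f := ε) (by
    rintro ⟨_, n, rfl⟩
    simpa using IsUnit.mk0 _ (pow_ne_zero n hs))
  have he : e.comp b = ε := by
    ext a
    simp [e, b]
  have h1 : (1 : specOver F F ⟶ G) = specOverMap e ≫ specOverMap b ≫ j := by
    rw [← Category.assoc, ← specOverMap_comp, he, hj]
  have h2 : (1 : specOver F F ⟶ G) = toUnit _ ≫ η[G] := Hom.one_def
  have h3 : η[G].left = (toUnit (specOver F F)).left ≫ η[G].left := by
    have h4 : (toUnit (specOver F F)).left = Spec.map (CommRingCat.ofHom (algebraMap F F)) := by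
      exact (Category.comp_id _).symm.trans (Over.w (toUnit (specOver F F)))
    have h5 : Spec.map (CommRingCat.ofHom (algebraMap F F)) = 𝟙 _ := Spec.map_id _
    rw [h4, h5]
    exact (Category.id_comp _).symm
  rw [h3, ← Over.comp_left, ← h2, h1, Over.comp_left]
  rintro _ ⟨p, rfl⟩
  exact ⟨_, rfl⟩

end Infinitesimal

end

end AlgGrp

/-! ### The algebra spanned by an infinitesimal neighbourhood -/

namespace AlgGrp

open scoped MonObj Matrix TensorProduct
open CartesianMonoidalCategory

noncomputable section

variable {F : Type u} [Field F]

/-- The linear form with coefficients `B` evaluated at a matrix `X`. -/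
def pairing {J R : Type*} [Fintype J] [CommRing R] [Algebra F R] (X : Matrix J J R) :
    Matrix J J F →ₗ[F] R where
  toFun B := ∑ p, ∑ q, B p q • X p q
  map_add' B C := by simp [add_smul, Finset.sum_add_distrib]
  map_smul' a B := by simp [Finset.smul_sum, mul_smul]

theorem pairing_apply {J R : Type*} [Fintype J] [CommRing R] [Algebra F R] (X : Matrix J J R)
    (B : Matrix J J F) : pairing X B = ∑ p, ∑ q, B p q • X p q := rfl

theorem pairing_map {J R R' : Type*} [Fintype J] [CommRing R] [Algebra F R] [CommRing R']
    [Algebra F R'] (f : R →ₗ[F] R') (X : Matrix J J R) (B : Matrix J J F) :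
    pairing (X.map f) B = f (pairing X B) := by
  simp [pairing_apply, map_sum]

theorem exists_pairing_ne_zero {J : Type*} [Fintype J] (E : Submodule F (Matrix J J F))
    {X : Matrix J J F} (hX : X ∉ E) :
    ∃ B : Matrix J J F, (∀ Y ∈ E, pairing Y B = 0) ∧ pairing X B ≠ 0 := by
  classical
  obtain ⟨f, hf, hE⟩ := Submodule.exists_le_ker_of_notMem hX
  have key : ∀ Y : Matrix J J F, pairing Y (Matrix.of fun p q => f (Matrix.single p q 1)) = f Y := by
    intro Y
    conv_rhs => rw [Matrix.matrix_eq_sum_single Y]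
    simp only [map_sum, pairing_apply, Matrix.of_apply, smul_eq_mul]
    refine Finset.sum_congr rfl fun p _ => Finset.sum_congr rfl fun q _ => ?_
    rw [mul_comm, ← smul_eq_mul, ← map_smul, Matrix.smul_single, smul_eq_mul, mul_one]
  exact ⟨_, fun Y hY => (key Y).trans (hE hY), by rwa [key]⟩

/-- This realizes a product of two elements of the span as a functional l ⊗ l' applied to a product
of two points over R ⊗ R. -/
theorem map_includeLeft_mul_map_includeRight {J : Type*} [Fintype J] {R : Type u} [CommRing R]
    [Algebra F R] (X Y : Matrix J J R) (l l' : R →ₗ[F] F) :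
    ((X.map (Algebra.TensorProduct.includeLeft : R →ₐ[F] R ⊗[F] R) *
      Y.map (Algebra.TensorProduct.includeRight : R →ₐ[F] R ⊗[F] R)).map
        (LinearMap.mul' F F ∘ₗ TensorProduct.map l l')) = X.map l * Y.map l' := by
  ext p q
  simp [Matrix.mul_apply, map_sum]

/-- For a maximal ideal `ker ε` of a noetherian algebra `A`, linear combinations of finitely many
elements that lie in a high power of `ker ε` vanish near the corresponding point. -/
theorem exists_pow_ker_le {V A : Type*} [AddCommGroup V] [Module F V] [FiniteDimensional F V]
    [CommRing A] [Algebra F A] [IsNoetherianRing A] (ε : A →ₐ[F] F) (φ : V →ₗ[F] A) :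
    ∃ N, 1 ≤ N ∧ ∀ v, φ v ∈ RingHom.ker ε ^ N → ∃ s, ε s ≠ 0 ∧ s * φ v = 0 := by
  -- The preimages of the powers of ker ε form a decreasing chain in a finite-dimensional space, so
  -- they stabilize.
  let K : ℕ →o (Submodule F V)ᵒᵈ :=
    { toFun := fun n => OrderDual.toDual
        (Submodule.comap φ ((RingHom.ker ε ^ n).restrictScalars F))
      monotone' := fun m n h => OrderDual.toDual_le_toDual.mpr
        (Submodule.comap_mono (Ideal.pow_le_pow_right h)) }
  obtain ⟨N, hN⟩ := monotone_stabilizes_iff_artinian.mpr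
    (inferInstanceAs (IsArtinian F V)) K
  have hK : ∀ n, N ≤ n → ∀ v, φ v ∈ RingHom.ker ε ^ N → φ v ∈ RingHom.ker ε ^ n := by
    intro n hn v hv
    have : v ∈ OrderDual.ofDual (K n) := by rw [← hN n hn]; exact hv
    exact this
  -- The extra 1 makes the exponent positive, so that ε descends to the quotient by this power.
  refine ⟨N + 1, by omega, fun v hv => ?_⟩
  have hv' : φ v ∈ RingHom.ker ε ^ N := Ideal.pow_le_pow_right (Nat.le_succ N) hv
  have : φ v ∈ (⨅ i : ℕ, RingHom.ker ε ^ i • ⊤ : Submodule A A) := by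
    rw [Submodule.mem_iInf]
    intro i
    rw [smul_eq_mul, Ideal.mul_top]
    rcases le_total N i with h | h
    · exact hK i h v hv'
    · exact Ideal.pow_le_pow_right h hv'
  -- Krull: φ v lies in every power of ker ε, hence is fixed by some r in ker ε, and 1 - r kills it.
  obtain ⟨r, hr⟩ := (Ideal.mem_iInf_smul_pow_eq_bot_iff _ _).mp this
  have hr0 : ε r = 0 := r.2
  refine ⟨1 - r, by simp [hr0], ?_⟩
  rw [sub_mul, one_mul, sub_eq_zero]
  exact hr.symm

variable {G : Over (Spec (CommRingCat.of F))} [GrpObj G] {J : Type} [Fintype J] [DecidableEq J]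

namespace AlgRep

variable {R R' : Type u} [CommRing R] [Algebra F R] [CommRing R'] [Algebra F R']

/-- The value of a representation at the universal point of `G`. -/
def generic (ρ : AlgRep G J) : Matrix J J Γ(G.left, ⊤) :=
  (ρ.toHom G (𝟙 G) : Matrix J J Γ(G.left, ⊤))

theorem toHom_eq (ρ : AlgRep G J) (T : Over (Spec (CommRingCat.of F))) (g : T ⟶ G) :
    (ρ.toHom T g : Matrix J J Γ(T.left, ⊤)) = ρ.generic.map g.left.appTop.hom := by
  have := ρ.naturality g (𝟙 G)
  rw [Category.comp_id] at this
  rw [this]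
  rfl

/-- The value of a representation at an `R`-valued point of `G`. -/
def eval (ρ : AlgRep G J) (g : specOver F R ⟶ G) : Matrix J J R :=
  ρ.generic.map (pull g)

theorem eval_eq (ρ : AlgRep G J) (g : specOver F R ⟶ G) :
    ρ.eval g = (Scheme.ΓSpecIso (CommRingCat.of R)).hom.hom.mapMatrix
      (ρ.toHom _ g : Matrix J J Γ((specOver F R).left, ⊤)) := by
  rw [toHom_eq]
  rfl

theorem eval_one (ρ : AlgRep G J) : ρ.eval (1 : specOver F R ⟶ G) = 1 := by
  rw [eval_eq, map_one, Units.val_one, map_one]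

theorem eval_mul (ρ : AlgRep G J) (x y : specOver F R ⟶ G) :
    ρ.eval (x * y) = ρ.eval x * ρ.eval y := by
  rw [eval_eq, eval_eq, eval_eq, map_mul, Units.val_mul, map_mul]

theorem eval_comp (ρ : AlgRep G J) (f : R →ₐ[F] R') (x : specOver F R ⟶ G) :
    ρ.eval (specOverMap f ≫ x) = (ρ.eval x).map f := by
  rw [eval, pull_specOverMap_comp]
  rfl

/-- The matrix coefficient of a representation given by a linear form on matrices. -/
def coeff (ρ : AlgRep G J) (B : Matrix J J F) : Γ(G.left, ⊤) :=
  ∑ p, ∑ q, scalars G (B p q) * ρ.generic p q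

theorem pull_coeff (ρ : AlgRep G J) (B : Matrix J J F) (x : specOver F R ⟶ G) :
    pull x (ρ.coeff B) = pairing (ρ.eval x) B := by
  simp only [coeff, pairing_apply, map_sum, map_mul, pull_scalars, Algebra.smul_def]
  rfl

/-- The algebra spanned by the image of an infinitesimal neighbourhood of the identity: the linear
forms vanishing on it are those whose matrix coefficient vanishes near the identity. -/
theorem exists_subalgebra {A : Type u} [CommRing A] [Algebra F A] [IsNoetherianRing A]
    {j : specOver F A ⟶ G} {ε : A →ₐ[F] F} [IsOpenImmersion j.left]
    (hj : specOverMap ε ≫ j = 1) (ρ : AlgRep G J) :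
    ∃ E : Subalgebra F (Matrix J J F),
      ∀ B, (∀ X ∈ E, pairing X B = 0) ↔ LocZero j ε (ρ.coeff B) := by
  obtain ⟨N, hN1, hN⟩ := exists_pow_ker_le ε (pairing (F := F) (ρ.eval j))
  let R := A ⧸ RingHom.ker ε ^ N
  let π : A →ₐ[F] R := Ideal.Quotient.mkₐ F _
  let x : specOver F R ⟶ G := specOverMap π ≫ j
  have hx : IsInfinitesimal x := isInfinitesimal_quotient_pow hj N
  -- The span of the values of ρ on the neighbourhood: apply every F-linear functional on R
  -- entrywise to ρ(x).
  let E : Submodule F (Matrix J J F) := LinearMap.range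
    ({ toFun := fun l => (ρ.eval x).map l
       map_add' := fun l l' => by ext; simp
       map_smul' := fun a l => by ext; simp } : (R →ₗ[F] F) →ₗ[F] Matrix J J F)
  have hE : ∀ B, (∀ X ∈ E, pairing X B = 0) ↔ LocZero j ε (ρ.coeff B) := by
    intro B
    constructor
    · intro h
      have h0 : pairing (ρ.eval x) B = 0 := by
        rw [← Module.forall_dual_apply_eq_zero_iff F]
        intro l
        rw [← pairing_map]
        exact h _ ⟨l, rfl⟩
      have h1 : pairing (ρ.eval j) B ∈ RingHom.ker ε ^ N := by
        rw [eval_comp] at h0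
        have h2 : π (pairing (ρ.eval j) B) = 0 := (pairing_map π.toLinearMap _ B).symm.trans h0
        exact Ideal.Quotient.eq_zero_iff_mem.mp h2
      obtain ⟨s, hs, hs0⟩ := hN B h1
      exact ⟨s, hs, by rwa [pull_coeff]⟩
    · rintro h _ ⟨l, rfl⟩
      have h0 := hx.pull_eq_zero hj h
      rw [pull_coeff] at h0
      change pairing ((ρ.eval x).map l) B = 0
      rw [pairing_map, h0, map_zero]
  have hone : (1 : Matrix J J F) ∈ E := by
    let εN : R →ₐ[F] F := Ideal.Quotient.liftₐ _ ε fun a ha =>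
      Ideal.pow_le_self (by omega) ha
    have hε : εN.comp π = ε := by ext a; rfl
    refine ⟨εN.toLinearMap, ?_⟩
    change (ρ.eval x).map εN = 1
    rw [← eval_comp, ← Category.assoc, ← specOverMap_comp, hε, hj, eval_one]
  have hmul : ∀ X Y, X ∈ E → Y ∈ E → X * Y ∈ E := by
    rintro _ _ ⟨l, rfl⟩ ⟨l', rfl⟩
    change (ρ.eval x).map l * (ρ.eval x).map l' ∈ E
    -- A form B separating the product from E kills E, so its coefficient vanishes near the identity
    -- and hence at the infinitesimal product point over R ⊗ R. Applying l ⊗ l' gives a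
    -- contradiction.
    by_contra hmem
    obtain ⟨B, hB, hne⟩ := exists_pairing_ne_zero E hmem
    apply hne
    let i₁ : R →ₐ[F] R ⊗[F] R := Algebra.TensorProduct.includeLeft
    let i₂ : R →ₐ[F] R ⊗[F] R := Algebra.TensorProduct.includeRight
    have h0 := ((hx.comp i₁).mul (hx.comp i₂)).pull_eq_zero hj ((hE B).mp hB)
    rw [pull_coeff, eval_mul, eval_comp ρ i₁ x, eval_comp ρ i₂ x] at h0
    rw [← map_includeLeft_mul_map_includeRight, pairing_map, h0, map_zero]
  exact ⟨{ carrier := E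
           mul_mem' := fun {X Y} => hmul X Y
           one_mem' := hone
           add_mem' := E.add_mem
           zero_mem' := E.zero_mem
           algebraMap_mem' := fun a => by
            rw [Algebra.algebraMap_eq_smul_one]
            exact E.smul_mem a hone }, hE⟩

end AlgRep

end

end AlgGrp

/-! ### Stable subspaces of the algebra and of the group -/

namespace AlgGrp

open scoped MonObj Matrix
open CartesianMonoidalCategory

noncomputable section

/-- A subalgebra of a matrix algebra is closed under inverses of invertible matrices. -/
theorem inv_mem_subalgebra {R J : Type*} [CommRing R] [Fintype J] [DecidableEq J]
    (B : Subalgebra R (Matrix J J R)) (X : GL J R) (hX : (X : Matrix J J R) ∈ B) :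
    ((X⁻¹ : GL J R) : Matrix J J R) ∈ B := by
  set M : Matrix J J R := (X : Matrix J J R) with hM
  have h0 := Matrix.aeval_self_charpoly M
  rw [← Polynomial.divX_mul_X_add M.charpoly, map_add, map_mul, Polynomial.aeval_X,
    Polynomial.aeval_C] at h0
  -- The constant coefficient is the determinant up to sign, so Cayley–Hamilton writes the inverse
  -- as a polynomial in M.
  have hc : IsUnit (M.charpoly.coeff 0) := by
    have hdet : IsUnit M.det := (Matrix.isUnit_iff_isUnit_det M).mp X.isUnit
    rw [Matrix.det_eq_sign_charpoly_coeff] at hdet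
    exact isUnit_of_mul_isUnit_right hdet
  obtain ⟨c, hc⟩ := hc
  have h1 : ((X⁻¹ : GL J R) : Matrix J J R) =
      -((↑c⁻¹ : R) • Polynomial.aeval M M.charpoly.divX) := by
    have h2 := congr($h0 * ((X⁻¹ : GL J R) : Matrix J J R))
    rw [add_mul, mul_assoc, hM, Units.mul_inv, mul_one, zero_mul, ← hM, ← hc,
      Algebra.algebraMap_eq_smul_one, smul_mul_assoc, one_mul] at h2
    rw [eq_neg_of_add_eq_zero_left h2, smul_neg, neg_neg, smul_smul, Units.inv_mul, one_smul]
  rw [h1]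
  refine B.neg_mem (B.smul_mem ?_ _)
  exact (Algebra.adjoin_le (Set.singleton_subset_iff.mpr hX) : Algebra.adjoin R {M} ≤ B)
    (Polynomial.aeval_mem_adjoin_singleton R M)

/-- The algebra of matrices stabilizing the image of an idempotent `p`. -/
def idempotentStabilizer {R J : Type*} [CommRing R] [Fintype J] [DecidableEq J]
    (p : Matrix J J R) (hp : p * p = p) : Subalgebra R (Matrix J J R) where
  carrier := {X | (1 - p) * X * p = 0}
  mul_mem' {X Y} hX hY := by
    have hX : (1 - p) * X * p = 0 := hX
    have hY : (1 - p) * Y * p = 0 := hY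
    have : (1 - p) * (X * Y) * p =
        ((1 - p) * X * p) * (Y * p) + (1 - p) * X * ((1 - p) * Y * p) := by noncomm_ring
    rw [Set.mem_ofPred_eq, this, hX, hY, zero_mul, mul_zero, add_zero]
  add_mem' {X Y} hX hY := by
    have hX : (1 - p) * X * p = 0 := hX
    have hY : (1 - p) * Y * p = 0 := hY
    rw [Set.mem_ofPred_eq, mul_add, add_mul, hX, hY, add_zero]
  algebraMap_mem' a := by
    rw [Set.mem_ofPred_eq, Algebra.algebraMap_eq_smul_one, mul_smul_comm, smul_mul_assoc, mul_one,
      sub_mul, one_mul, hp, sub_self, smul_zero]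

theorem mem_idempotentStabilizer {R J : Type*} [CommRing R] [Fintype J] [DecidableEq J]
    {p : Matrix J J R} {hp : p * p = p} {X : Matrix J J R} :
    X ∈ idempotentStabilizer p hp ↔ (1 - p) * X * p = 0 := Iff.rfl

theorem exists_projection_matrix {J : Type*} [Fintype J] [DecidableEq J] {F : Type*} [Field F]
    (W : Submodule F (J → F)) :
    ∃ p : Matrix J J F, (∀ v, p *ᵥ v ∈ W) ∧ ∀ v ∈ W, p *ᵥ v = v := by
  obtain ⟨f, hf⟩ := W.subtype.exists_leftInverse_of_injective W.ker_subtype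
  refine ⟨LinearMap.toMatrix' (W.subtype ∘ₗ f), fun v => ?_, fun v hv => ?_⟩
  · rw [LinearMap.toMatrix'_mulVec]
    exact (f v).2
  · rw [LinearMap.toMatrix'_mulVec]
    exact congr(($hf ⟨v, hv⟩ : J → F))

variable {F : Type u} [Field F] {G : Over (Spec (CommRingCat.of F))}

theorem trace_tensorPowMatrix {J R : Type*} [CommRing R] [Fintype J] [DecidableEq J] (k : ℕ)
    (A : Matrix J J R) : (tensorPowMatrix k A).trace = A.trace ^ k := by
  simp only [Matrix.trace, Matrix.diag, tensorPowMatrix, Matrix.of_apply]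
  exact (Fintype.sum_pow (fun q => A q q) k).symm

section LocZero

variable {A : Type u} [CommRing A] [Algebra F A] {j : specOver F A ⟶ G} {ε : A →ₐ[F] F}

theorem LocZero.exists_common {I : Type*} [Finite I] {f : I → Γ(G.left, ⊤)}
    (h : ∀ i, LocZero j ε (f i)) : ∃ s, ε s ≠ 0 ∧ ∀ i, s * pull j (f i) = 0 := by
  cases nonempty_fintype I
  choose s hs h using h
  refine ⟨∏ i, s i, by rw [map_prod]; exact Finset.prod_ne_zero_iff.mpr fun i _ => hs i,
    fun i => ?_⟩
  obtain ⟨c, hc⟩ := Finset.dvd_prod_of_mem s (Finset.mem_univ i)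
  rw [hc, mul_right_comm, h, zero_mul]

/-- Functions with equal `k`-th powers and the same nonzero value at the identity agree near the
identity. -/
theorem locZero_sub_of_pow_eq_pow [CharZero F] {a b : Γ(G.left, ⊤)} {k n : ℕ} (hk : k ≠ 0)
    (hn : n ≠ 0) (h : a ^ k = b ^ k) (ha : ε (pull j a) = n) (hb : ε (pull j b) = n) :
    LocZero j ε (a - b) := by
  -- The cofactor of a - b in a ^ k - b ^ k.
  refine ⟨∑ i ∈ Finset.range k, pull j a ^ i * pull j b ^ (k - 1 - i), ?_, ?_⟩
  · have : ε (∑ i ∈ Finset.range k, pull j a ^ i * pull j b ^ (k - 1 - i)) =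
        k * (n : F) ^ (k - 1) := by
      simp only [map_sum, map_mul, map_pow, ha, hb, ← pow_add]
      rw [Finset.sum_congr rfl fun i hi => by
        rw [show i + (k - 1 - i) = k - 1 by have := Finset.mem_range.mp hi; omega]]
      simp
    rw [this]
    exact mul_ne_zero (Nat.cast_ne_zero.mpr hk) (pow_ne_zero _ (Nat.cast_ne_zero.mpr hn))
  · rw [map_sub, geom_sum₂_mul, ← map_pow, ← map_pow, h, sub_self]

end LocZero

namespace AlgRep

/-- The linear form `X ↦ (Q * X * P) i k`. -/
def sandwich {J : Type*} (Q P : Matrix J J F) (i k : J) : Matrix J J F :=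
  Matrix.of fun a b => Q i a * P b k

theorem pairing_sandwich {J : Type*} [Fintype J] (Q P X : Matrix J J F) (i k : J) :
    pairing X (sandwich Q P i k) = (Q * X * P) i k := by
  simp only [pairing_apply, sandwich, Matrix.of_apply, Matrix.mul_apply, Finset.sum_mul,
    smul_eq_mul]
  rw [Finset.sum_comm]
  exact Finset.sum_congr rfl fun b _ => Finset.sum_congr rfl fun a _ => by ring

variable [GrpObj G] {J : Type} [Fintype J] [DecidableEq J]

theorem coeff_sandwich (ρ : AlgRep G J) (Q P : Matrix J J F) (i k : J) :
    ρ.coeff (sandwich Q P i k) =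
      (Q.map (scalars G) * ρ.generic * P.map (scalars G)) i k := by
  simp only [coeff, sandwich, Matrix.of_apply, Matrix.mul_apply, Finset.sum_mul, map_mul,
    Matrix.map_apply]
  rw [Finset.sum_comm]
  exact Finset.sum_congr rfl fun b _ => Finset.sum_congr rfl fun a _ => by ring

theorem map_sandwich (ρ : AlgRep G J) (Q P : Matrix J J F)
    (T : Over (Spec (CommRingCat.of F))) (g : T ⟶ G) :
    (Q.map (scalars G) * ρ.generic * P.map (scalars G)).map g.left.appTop.hom =
      Q.map (scalars T) * (ρ.toHom T g : Matrix J J Γ(T.left, ⊤)) * P.map (scalars T) := by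
  rw [Matrix.map_mul, Matrix.map_mul, toHom_eq]
  congr 1
  · congr 1
    ext p q
    exact appTop_scalars g _
  · ext p q
    exact appTop_scalars g _

/-- If the algebra spanned by an infinitesimal neighbourhood of the identity stabilizes the image of
an idempotent, then so does the whole connected group. -/
theorem stabilizes_iff [ConnectedSpace G.left] {A : Type u} [CommRing A] [Algebra F A]
    {j : specOver F A ⟶ G} {ε : A →ₐ[F] F} [IsOpenImmersion j.left]
    (hj : specOverMap ε ≫ j = 1) (ρ : AlgRep G J) {E : Subalgebra F (Matrix J J F)}
    (hE : ∀ B, (∀ X ∈ E, pairing X B = 0) ↔ LocZero j ε (ρ.coeff B))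
    {p : Matrix J J F} (hp : p * p = p) :
    (∀ X ∈ E, (1 - p) * X * p = 0) ↔
      (1 - p).map (scalars G) * ρ.generic * p.map (scalars G) = 0 := by
  constructor
  · intro h
    -- The entries of (1 - p) ρ p are the equations of the stabilizer of the image of p.
    let f : J × J → Γ(G.left, ⊤) := fun ik => ρ.coeff (sandwich (1 - p) p ik.1 ik.2)
    have hloc : ∀ ik, LocZero j ε (f ik) := fun ik => (hE _).mp fun X hX => by
      rw [pairing_sandwich, h X hX]; rfl
    obtain ⟨s, hs, hsf⟩ := LocZero.exists_common hloc
    have hkill : ∀ (T : Over (Spec (CommRingCat.of F))) (g : T ⟶ G),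
        KillsPullback (Set.range f) g.left ↔
          (1 - p).map (scalars T) * (ρ.toHom T g : Matrix J J Γ(T.left, ⊤)) * p.map (scalars T) =
            0 := by
      intro T g
      rw [← map_sandwich, KillsPullback, Set.forall_mem_range, ← Matrix.ext_iff, Prod.forall]
      simp only [f, coeff_sandwich]
      rfl
    have hzero := eq_zero_of_vanishing_near_one (Set.range f) (by
      intro T a b ha hb
      have hpT : p.map (scalars T) * p.map (scalars T) = p.map (scalars T) := by
        rw [← Matrix.map_mul, hp]
      have hmem : ∀ g : T ⟶ G, KillsPullback (Set.range f) g.left ↔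
          (ρ.toHom T g : Matrix J J Γ(T.left, ⊤)) ∈ idempotentStabilizer _ hpT := by
        intro g
        rw [hkill, mem_idempotentStabilizer, ← RingHom.mapMatrix_apply, map_sub, map_one]
        rfl
      rw [hmem] at ha hb ⊢
      rw [map_div, div_eq_mul_inv, Units.val_mul]
      exact mul_mem ha (inv_mem_subalgebra _ _ hb))
      (range_one_subset_vanishingOpens hj _ s hs (by rintro _ ⟨ik, rfl⟩; exact hsf ik))
    ext i k
    rw [← coeff_sandwich]
    exact hzero _ ⟨(i, k), rfl⟩
  · intro h X hX
    ext i k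
    rw [← pairing_sandwich]
    refine (hE _).mpr ?_ X hX
    rw [coeff_sandwich, h]
    exact ⟨1, by simp, by simp⟩

theorem mem_baseChange_iff {W : Submodule F (J → F)} {p : Matrix J J F}
    (hpW : ∀ v, p *ᵥ v ∈ W) (hWp : ∀ v ∈ W, p *ᵥ v = v)
    (T : Over (Spec (CommRingCat.of F))) (v : J → Γ(T.left, ⊤)) :
    v ∈ baseChange W T ↔ p.map (scalars T) *ᵥ v = v := by
  constructor
  · intro hv
    induction hv using Submodule.span_induction with
    | mem x hx =>
      obtain ⟨w, hw, rfl⟩ := hx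
      conv_rhs => rw [← hWp w hw]
      ext i
      exact (RingHom.map_mulVec (scalars T) p w i).symm
    | zero => rw [Matrix.mulVec_zero]
    | add x y _ _ hx hy => rw [Matrix.mulVec_add, hx, hy]
    | smul a x _ hx => rw [Matrix.mulVec_smul, hx]
  · intro h
    rw [← h, Matrix.mulVec_eq_sum]
    refine Submodule.sum_mem _ fun i _ => ?_
    rw [op_smul_eq_smul]
    refine Submodule.smul_mem _ _ (Submodule.subset_span ⟨p *ᵥ Pi.single i 1, hpW _, ?_⟩)
    ext q
    simp

/-- W_T consists of the vectors fixed by p, so stability is a matrix identity. It suffices to check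
it at the universal point, from which every other point is pulled back. -/
theorem isSubrep_iff (ρ : AlgRep G J) {W : Submodule F (J → F)} {p : Matrix J J F}
    (hpW : ∀ v, p *ᵥ v ∈ W) (hWp : ∀ v ∈ W, p *ᵥ v = v) :
    ρ.IsSubrep W ↔ (1 - p).map (scalars G) * ρ.generic * p.map (scalars G) = 0 := by
  have hp : p * p = p := by
    apply Matrix.ext_of_mulVec_single
    intro i
    rw [← Matrix.mulVec_mulVec, hWp _ (hpW _)]
  have hsub : ∀ T : Over (Spec (CommRingCat.of F)),
      (1 - p).map (scalars T) = 1 - p.map (scalars T) := by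
    intro T
    rw [← RingHom.mapMatrix_apply, map_sub, map_one]; rfl
  constructor
  · intro h
    apply Matrix.ext_of_mulVec_single
    intro i
    have h1 : p.map (scalars G) *ᵥ Pi.single i 1 ∈ baseChange W G := by
      rw [mem_baseChange_iff hpW hWp, Matrix.mulVec_mulVec, ← Matrix.map_mul, hp]
    have h2 := h G (𝟙 G) _ h1
    rw [mem_baseChange_iff hpW hWp] at h2
    rw [← Matrix.mulVec_mulVec, ← Matrix.mulVec_mulVec, hsub, Matrix.sub_mulVec, Matrix.one_mulVec,
      Matrix.zero_mulVec, sub_eq_zero]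
    exact h2.symm
  · intro h T g v hv
    rw [mem_baseChange_iff hpW hWp] at hv ⊢
    have h1 := map_sandwich ρ (1 - p) p T g
    rw [h] at h1
    have h2 := congr($h1 *ᵥ v)
    rw [← Matrix.mulVec_mulVec, ← Matrix.mulVec_mulVec, hv, hsub, Matrix.sub_mulVec,
      Matrix.one_mulVec] at h2
    have h3 : (0 : Matrix J J Γ(G.left, ⊤)).map g.left.appTop.hom = 0 := by ext; simp
    rw [h3, Matrix.zero_mulVec] at h2
    exact (sub_eq_zero.mp h2.symm).symm

end AlgRep

end

end AlgGrp

/-! ### Direct sums and comparison of the two representations -/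

namespace AlgGrp

open scoped MonObj Matrix
open CartesianMonoidalCategory

noncomputable section

/-- The block diagonal embedding `GL_J × GL_J → GL_{J ⊕ J}`. -/
def blockDiagHom (J R : Type*) [CommRing R] [Fintype J] [DecidableEq J] :
    GL J R × GL J R →* GL (J ⊕ J) R :=
  (Units.map
    { toFun := fun X : Matrix J J R × Matrix J J R => Matrix.fromBlocks X.1 0 0 X.2
      map_one' := Matrix.fromBlocks_one
      map_mul' := fun X Y => by simp [Matrix.fromBlocks_multiply] }).comp
    MulEquiv.prodUnits.symm.toMonoidHom

variable {F : Type u} [Field F] {G : Over (Spec (CommRingCat.of F))} [GrpObj G]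
  {J : Type} [Fintype J] [DecidableEq J]

namespace AlgRep

theorem coeff_single (ρ : AlgRep G J) (p q : J) :
    ρ.coeff (Matrix.single p q (1 : F)) = ρ.generic p q := by
  rw [coeff, Finset.sum_eq_single p, Finset.sum_eq_single q]
  · simp
  · intro b _ hb
    simp [hb.symm]
  · simp
  · intro b _ hb
    simp [hb.symm]
  · simp

theorem pairing_single (X : Matrix J J F) (p q : J) :
    pairing X (Matrix.single p q (1 : F)) = X p q := by
  rw [pairing_apply, Finset.sum_eq_single p, Finset.sum_eq_single q]
  · simp
  · intro b _ hb
    simp [hb.symm]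
  · simp
  · intro b _ hb
    simp [hb.symm]
  · simp

/-- The direct sum of two representations. -/
def directSum (ρ₁ ρ₂ : AlgRep G J) : AlgRep G (J ⊕ J) where
  toHom T := (blockDiagHom J Γ(T.left, ⊤)).comp ((ρ₁.toHom T).prod (ρ₂.toHom T))
  naturality f g := by
    ext p q
    rcases p with p | p <;> rcases q with q | q <;>
      simp [blockDiagHom, ρ₁.naturality, ρ₂.naturality] <;> rfl

theorem generic_directSum (ρ₁ ρ₂ : AlgRep G J) :
    (ρ₁.directSum ρ₂).generic = Matrix.fromBlocks ρ₁.generic 0 0 ρ₂.generic := rfl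

theorem trace_pow_eq_of_equivalent_tensorPow {ρ₁ ρ₂ : AlgRep G J} {k : ℕ}
    (h : (ρ₁.tensorPow k).Equivalent (ρ₂.tensorPow k)) :
    ρ₁.generic.trace ^ k = ρ₂.generic.trace ^ k := by
  obtain ⟨P, hP⟩ := h
  have h1 : ∀ ρ : AlgRep G J, ((ρ.tensorPow k).toHom G (𝟙 G) : Matrix _ _ Γ(G.left, ⊤)) =
      tensorPowMatrix k ρ.generic := fun ρ => rfl
  rw [← trace_tensorPowMatrix, ← trace_tensorPowMatrix, ← h1, ← h1,
    ← Matrix.trace_units_conj (Matrix.GeneralLinearGroup.map (scalars G) P)]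
  congr 1
  rw [← Units.val_mul, hP, Units.val_mul, mul_assoc, Units.mul_inv, mul_one]

/-- The diagonal blocks of matrices in a subalgebra of block diagonal matrices. -/
def fstBlock (E : Subalgebra F (Matrix (J ⊕ J) (J ⊕ J) F))
    (h : ∀ X ∈ E, X.toBlocks₁₂ = 0) : E →ₐ[F] Matrix J J F where
  toFun X := X.1.toBlocks₁₁
  map_one' := by ext p q; simp [Matrix.toBlocks₁₁, Matrix.one_apply]
  map_mul' X Y := by
    have := h X X.2
    conv_lhs => rw [Subalgebra.coe_mul, ← Matrix.fromBlocks_toBlocks X.1,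
      ← Matrix.fromBlocks_toBlocks Y.1, Matrix.fromBlocks_multiply, this]
    simp
  map_zero' := rfl
  map_add' _ _ := rfl
  commutes' a := by ext p q; simp [Matrix.toBlocks₁₁, Matrix.algebraMap_matrix_apply]

/-- The diagonal blocks of matrices in a subalgebra of block diagonal matrices. -/
def sndBlock (E : Subalgebra F (Matrix (J ⊕ J) (J ⊕ J) F))
    (h : ∀ X ∈ E, X.toBlocks₁₂ = 0) : E →ₐ[F] Matrix J J F where
  toFun X := X.1.toBlocks₂₂
  map_one' := by ext p q; simp [Matrix.toBlocks₂₂, Matrix.one_apply]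
  map_mul' X Y := by
    have := h Y Y.2
    conv_lhs => rw [Subalgebra.coe_mul, ← Matrix.fromBlocks_toBlocks X.1,
      ← Matrix.fromBlocks_toBlocks Y.1, Matrix.fromBlocks_multiply, this]
    simp
  map_zero' := rfl
  map_add' _ _ := rfl
  commutes' a := by ext p q; simp [Matrix.toBlocks₂₂, Matrix.algebraMap_matrix_apply]

/-- Every subspace is the image of an idempotent, so `hα` says that D-stable subspaces and
subrepresentations coincide. Complements then carry over. -/
theorem isSemisimpleModule_of_isSemisimple {D : Type*} [Ring D] [Algebra F D] {ρ : AlgRep G J}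
    (hρ : ρ.IsSemisimple) (α : D →ₐ[F] Matrix J J F)
    (hα : ∀ p : Matrix J J F, p * p = p → ((∀ d, (1 - p) * α d * p = 0) ↔
      (1 - p).map (scalars G) * ρ.generic * p.map (scalars G) = 0)) :
    IsSemisimpleModule D (MatrixModule α) := by
  have key : ∀ W : Submodule F (J → F), (∀ d, ∀ v ∈ W, α d *ᵥ v ∈ W) ↔ ρ.IsSubrep W := by
    intro W
    obtain ⟨p, hpW, hWp⟩ := exists_projection_matrix W
    have hp : p * p = p := by
      apply Matrix.ext_of_mulVec_single
      intro i
      rw [← Matrix.mulVec_mulVec, hWp _ (hpW _)]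
    rw [isSubrep_iff ρ hpW hWp, ← hα p hp]
    refine forall_congr' fun d => ⟨fun h => ?_, fun h v hv => ?_⟩
    · apply Matrix.ext_of_mulVec_single
      intro i
      rw [← Matrix.mulVec_mulVec, ← Matrix.mulVec_mulVec, Matrix.sub_mulVec, Matrix.one_mulVec,
        hWp _ (h _ (hpW _)), sub_self, Matrix.zero_mulVec]
    · have h2 := congr($h *ᵥ v)
      rw [← Matrix.mulVec_mulVec, ← Matrix.mulVec_mulVec, hWp v hv, Matrix.sub_mulVec,
        Matrix.one_mulVec, Matrix.zero_mulVec, sub_eq_zero] at h2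
      rw [h2]
      exact hpW _
  refine MatrixModule.isSemisimpleModule α fun W hW => ?_
  obtain ⟨W', hW', hc⟩ := hρ W ((key W).mp hW)
  exact ⟨W', (key W').mpr hW', hc⟩

/-- Semisimple representations of a connected algebraic group in characteristic zero are isomorphic
if their characters agree near the identity. -/
theorem equivalent_of_locZero_trace_sub [CharZero F] [ConnectedSpace G.left]
    {A : Type u} [CommRing A] [Algebra F A] [IsNoetherianRing A]
    {j : specOver F A ⟶ G} {ε : A →ₐ[F] F} [IsOpenImmersion j.left]
    (hj : specOverMap ε ≫ j = 1) {ρ₁ ρ₂ : AlgRep G J}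
    (hρ₁ : ρ₁.IsSemisimple) (hρ₂ : ρ₂.IsSemisimple)
    (h : LocZero j ε (ρ₁.generic.trace - ρ₂.generic.trace)) :
    ρ₁.Equivalent ρ₂ := by
  obtain ⟨E, hE⟩ := exists_subalgebra hj (ρ₁.directSum ρ₂)
  have hentry : ∀ p q, (ρ₁.directSum ρ₂).generic p q = 0 → ∀ X ∈ E, X p q = 0 := by
    intro p q hpq X hX
    rw [← pairing_single X]
    refine (hE _).mpr ?_ X hX
    rw [coeff_single, hpq]
    exact ⟨1, by simp, by simp⟩
  have h12 : ∀ X ∈ E, X.toBlocks₁₂ = 0 := fun X hX => by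
    ext p q; exact hentry _ _ rfl X hX
  have h21 : ∀ X ∈ E, X.toBlocks₂₁ = 0 := fun X hX => by
    ext p q; exact hentry _ _ rfl X hX
  have hX : ∀ X : E, X.1 = Matrix.fromBlocks (fstBlock E h12 X) 0 0 (sndBlock E h12 X) := by
    intro X
    conv_lhs => rw [← Matrix.fromBlocks_toBlocks X.1, h12 X X.2, h21 X X.2]
    rfl
  have hsub : ∀ p : Matrix (J ⊕ J) (J ⊕ J) F,
      (1 - p).map (scalars G) = 1 - p.map (scalars G) := by
    intro p
    rw [← RingHom.mapMatrix_apply, map_sub, map_one]; rfl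
  have hsub' : ∀ p : Matrix J J F,
      (1 - p).map (scalars G) = 1 - p.map (scalars G) := by
    intro p
    rw [← RingHom.mapMatrix_apply, map_sub, map_one]; rfl
  have hmap : ∀ a b c d : Matrix J J F, (Matrix.fromBlocks a b c d).map (scalars G) =
      Matrix.fromBlocks (a.map (scalars G)) (b.map (scalars G)) (c.map (scalars G))
        (d.map (scalars G)) := fun a b c d => Matrix.fromBlocks_map _ _ _ _ _
  have hblock : ∀ {R : Type u} [CommRing R] (a b c d x y : Matrix J J R),
      (1 - Matrix.fromBlocks a b c d) * Matrix.fromBlocks x 0 0 y * Matrix.fromBlocks a b c d =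
        Matrix.fromBlocks ((1 - a) * x * a - b * y * c) ((1 - a) * x * b - b * y * d)
          ((1 - d) * y * c - c * x * a) ((1 - d) * y * d - c * x * b) := by
    intro R _ a b c d x y
    rw [← Matrix.fromBlocks_one, sub_eq_add_neg, Matrix.fromBlocks_neg, Matrix.fromBlocks_add,
      Matrix.fromBlocks_multiply, Matrix.fromBlocks_multiply]
    congr 1 <;> noncomm_ring
  have hz : (0 : Matrix J J F).map (scalars G) = 0 := by ext; simp
  have h1 : (1 : Matrix J J F).map (scalars G) = 1 := map_one (scalars G).mapMatrix
  have stab := fun (p : Matrix (J ⊕ J) (J ⊕ J) F) (hp : p * p = p) =>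
    (show _ ↔ ∀ X : E, (1 - p) * X.1 * p = 0 from Subtype.forall.symm).symm.trans
      (stabilizes_iff hj (ρ₁.directSum ρ₂) hE hp)
  have hzero : ∀ {R : Type u} [CommRing R] (a b c d : Matrix J J R),
      Matrix.fromBlocks a b c d = 0 ↔ a = 0 ∧ b = 0 ∧ c = 0 ∧ d = 0 := by
    intro R _ a b c d
    rw [← Matrix.fromBlocks_zero, Matrix.fromBlocks_inj]
  have ss₁ : IsSemisimpleModule E (MatrixModule (fstBlock E h12)) := by
    refine isSemisimpleModule_of_isSemisimple hρ₁ _ fun p hp => ?_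
    -- A subspace of the first summand is tested inside the direct sum.
    have := stab (Matrix.fromBlocks p 0 0 0) (by simp [Matrix.fromBlocks_multiply, hp])
    simp_rw [hsub, hX, hmap, hz, generic_directSum, hblock, hzero] at this
    rw [hsub']
    simpa using this
  have ss₂ : IsSemisimpleModule E (MatrixModule (sndBlock E h12)) := by
    refine isSemisimpleModule_of_isSemisimple hρ₂ _ fun p hp => ?_
    have := stab (Matrix.fromBlocks 0 0 0 p) (by simp [Matrix.fromBlocks_multiply, hp])
    simp_rw [hsub, hX, hmap, hz, generic_directSum, hblock, hzero] at this
    rw [hsub']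
    simpa using this
  obtain ⟨P, hP⟩ := exists_GL_conj_of_trace_eq (fstBlock E h12) (sndBlock E h12) (by
    intro X
    -- Pairing with this matrix gives the difference of the traces of the diagonal blocks.
    have h2 := (hE (Matrix.fromBlocks 1 0 0 (-1))).mpr (by
      convert h using 1
      simp [coeff, generic_directSum, Matrix.one_apply, Matrix.trace, sub_eq_add_neg]) X X.2
    rw [hX X] at h2
    simpa [pairing_apply, Matrix.one_apply, Matrix.trace, add_neg_eq_zero] using h2)
  refine ⟨P, fun T g => ?_⟩
  -- This idempotent projects onto the graph of P. Its image is stable exactly when P intertwines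
  -- the two blocks.
  have h3 := (stab (Matrix.fromBlocks 1 0 P 0) (by simp [Matrix.fromBlocks_multiply])).mp (by
    intro X
    rw [hX, hblock]
    simp [hP X])
  rw [hsub, hmap, hz, h1, generic_directSum, hblock, hzero] at h3
  have h5 : (P : Matrix J J F).map (scalars G) * ρ₁.generic =
      ρ₂.generic * (P : Matrix J J F).map (scalars G) := by
    have h4 := h3.2.2.1
    rw [sub_zero, one_mul, mul_one, sub_eq_zero] at h4
    exact h4.symm
  have h7 := congr(($h5).map g.left.appTop.hom)
  rw [Matrix.map_mul, Matrix.map_mul, ← toHom_eq, ← toHom_eq] at h7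
  have h8 : ((P : Matrix J J F).map (scalars G)).map g.left.appTop.hom =
      (P : Matrix J J F).map (scalars T) := by
    ext p q
    exact appTop_scalars g _
  rw [h8] at h7
  exact Units.ext h7

end AlgRep

end

end AlgGrp

theorem proposition2p1 {F : Type u} [Field F] [CharZero F]
    (G : Over (Spec (CommRingCat.of F))) [GrpObj G]
    [LocallyOfFiniteType G.hom] [QuasiCompact G.hom] [ConnectedSpace G.left]
    {n : ℕ} (ρ₁ ρ₂ : AlgGrp.AlgRep G (Fin n))
    (hρ₁ : ρ₁.IsSemisimple) (hρ₂ : ρ₂.IsSemisimple)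
    {k : ℕ} (hk : 1 ≤ k)
    (h : (ρ₁.tensorPow k).Equivalent (ρ₂.tensorPow k)) :
    ρ₁.Equivalent ρ₂ := by
  -- For n = 0 the characters vanish at the identity and the cofactor argument is not available.
  rcases Nat.eq_zero_or_pos n with rfl | hn
  · exact ⟨1, fun T g => Units.ext (Subsingleton.elim _ _)⟩
  obtain ⟨A, _, _, j, ε, _, _, hj⟩ := AlgGrp.exists_affine_nhd_one G
  have hone : ∀ ρ : AlgGrp.AlgRep G (Fin n), ε (AlgGrp.pull j ρ.generic.trace) = n := by
    intro ρ
    have h1 := ρ.eval_comp ε j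
    rw [hj, ρ.eval_one] at h1
    have h2 := congr(($h1).trace)
    rw [Matrix.trace_one, Fintype.card_fin] at h2
    rw [h2]
    simp [Matrix.trace, AlgGrp.AlgRep.eval]
  exact AlgGrp.AlgRep.equivalent_of_locZero_trace_sub hj hρ₁ hρ₂
    (AlgGrp.locZero_sub_of_pow_eq_pow (by omega) hn.ne'
      (AlgGrp.AlgRep.trace_pow_eq_of_equivalent_tensorPow h) (hone ρ₁) (hone ρ₂))
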